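/- For $a,b>0$ let $E=\{x\in\mathbb R^2: x_1^2/a^2+x_2^2/b^2<1\}$, let $ds$ be the line element on $\partial E$ and $\nu_y$ the outward unit normal at $y\in\partial E$. Let $H^{1/2}(\partial E)$ be the space of complex-valued $h\in L^2(\partial E,ds)$ with $$\|h\|_{H^{1/2}}^2=\int_{\partial E}|h|^2\,ds+\int_{\partial E}\int_{\partial E}\frac{|h(x)-h(z)|^2}{|x-z|^2}\,ds(x)\,ds(z)<\infty .$$ The Neumann--Poincar\'e (NP) operator on $\partial E$ is $$\mathcal K_{\partial E}[\varphi](x)=\mathrm{p.v.}\,\frac1{2\pi}\int_{\partial E}\frac{\langle y-x,\nu_y\rangle}{|x-y|^2}\,\varphi(y)\,ds(y),\qquad x\in\partial E,$$ and $\sigma(\mathcal K_{\partial E})\subset\mathbb C$ denotes its spectrum as a bounded operator on $H^{1/2}(\partial E)$. Let $(a_j)_{j\ge1}$ and $(b_j)_{j\ge1}$ be sequences of positive numbers with $b_j<a_j$ for all $j$ and $b_j/a_j\to0$ as $j\to\infty$, and let $E_j$ be the ellipse $x_1^2/a_j^2+x_2^2/b_j^2<1$. Then each $\mathcal K_{\partial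 E_j}$ is a well-defined bounded operator on $H^{1/2}(\partial E_j)$ (the principal value exists for almost every $x\in\partial E_j$), and $$\overline{\bigcup_{j=1}^\infty\sigma(\mathcal K_{\partial E_j})}=[-1/2,1/2].$$ -/

import Mathlib

open MeasureTheory Filter Topology

noncomputable section

/-- The Euclidean plane. -/
abbrev Plane : Type := EuclideanSpace ℝ (Fin 2)

/-- The open elliptic domain `x₁² / a² + x₂² / b² < 1`. -/
def ellipse (a b : ℝ) : Set Plane := {x | x 0 ^ 2 / a ^ 2 + x 1 ^ 2 / b ^ 2 < 1}

/-- The standard parametrization `t ↦ (a cos t, b sin t)` of the boundary of the ellipse. -/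
def ellipseCurve (a b : ℝ) (t : ℝ) : Plane := !₂[a * Real.cos t, b * Real.sin t]

/-- The line element `ds` on the boundary of the ellipse, as a measure on the plane:
`∫ f ds = ∫_{(0, 2π]} f (γ t) ‖γ' t‖ dt`, where `γ` is the standard parametrization. -/
def lineElement (a b : ℝ) : Measure Plane :=
  Measure.map (ellipseCurve a b)
    ((volume.restrict (Set.Ioc 0 (2 * Real.pi))).withDensity
      fun t => ENNReal.ofReal ‖deriv (ellipseCurve a b) t‖)

instance lineElement_sFinite (a b : ℝ) : SFinite (lineElement a b) := by
  unfold lineElement; infer_instance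

/-- The outward unit normal `ν_y` at a boundary point `y` of the ellipse: the normalized gradient
of the defining function `x₁² / a² + x₂² / b²` (up to the factor `2`). -/
def outwardNormal (a b : ℝ) (y : Plane) : Plane :=
  (‖(!₂[y 0 / a ^ 2, y 1 / b ^ 2] : Plane)‖)⁻¹ • (!₂[y 0 / a ^ 2, y 1 / b ^ 2] : Plane)

/-- The kernel `(1 / 2π) ⟨y - x, ν_y⟩ / |x - y|²` of the Neumann–Poincaré operator. -/
def npKernel (a b : ℝ) (x y : Plane) : ℝ :=
  1 / (2 * Real.pi) * (inner ℝ (y - x) (outwardNormal a b y) / ‖x - y‖ ^ 2)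

/-- The Sobolev space `H^{1/2}` over a curve with line element `σ`, with complex values: the
functions `h ∈ L²(σ)` whose difference quotient `(h x - h z) / |x - z|` lies in `L²(σ × σ)`.
An element is the pair consisting of `h` and its difference quotient, and the norm inherited from
the `ℓ²`-product is
`‖h‖² = ∫ |h|² dσ + ∫∫ |h x - h z|² / |x - z|² dσ(x) dσ(z)`. -/
def sobolevHalf (σ : Measure Plane) [SFinite σ] :
    Submodule ℂ (WithLp 2 (Lp ℂ 2 σ × Lp ℂ 2 (σ.prod σ))) where
  carrier := {p | ∀ᵐ q ∂(σ.prod σ), p.snd q = (p.fst q.1 - p.fst q.2) / (‖q.1 - q.2‖ : ℂ)}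
  zero_mem' := by
    have h1 := Lp.coeFn_zero ℂ 2 σ
    have h2 := Lp.coeFn_zero ℂ 2 (σ.prod σ)
    filter_upwards [h2, Measure.quasiMeasurePreserving_fst.ae h1,
      Measure.quasiMeasurePreserving_snd.ae h1] with q e2 e3 e4
    simp only [WithLp.zero_fst, WithLp.zero_snd]
    rw [e2, e3, e4]
    simp
  add_mem' := by
    intro p r hp hr
    have h1 := Lp.coeFn_add p.fst r.fst
    have h2 := Lp.coeFn_add p.snd r.snd
    filter_upwards [hp, hr, h2, Measure.quasiMeasurePreserving_fst.ae h1,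
      Measure.quasiMeasurePreserving_snd.ae h1] with q e0 e1 e2 e3 e4
    simp only [WithLp.add_fst, WithLp.add_snd]
    rw [e2, e3, e4]
    simp only [Pi.add_apply]
    rw [e0, e1]
    ring
  smul_mem' := by
    intro c p hp
    have h1 := Lp.coeFn_smul c p.fst
    have h2 := Lp.coeFn_smul c p.snd
    filter_upwards [hp, h2, Measure.quasiMeasurePreserving_fst.ae h1,
      Measure.quasiMeasurePreserving_snd.ae h1] with q e0 e2 e3 e4
    simp only [WithLp.smul_fst, WithLp.smul_snd]
    rw [e2, e3, e4]
    simp only [Pi.smul_apply, smul_eq_mul]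
    rw [e0]
    ring

/-- The space `H^{1/2}` on the boundary of the ellipse with semi-axes `a`, `b`. -/
abbrev HHalf (a b : ℝ) : Type := sobolevHalf (lineElement a b)

/-- The function (class) on the boundary that underlies an element of `H^{1/2}`. -/
def HHalf.toLp {a b : ℝ} (φ : HHalf a b) : Lp ℂ 2 (lineElement a b) := φ.1.fst

/-- `T` is the Neumann–Poincaré operator of the ellipse, as a bounded operator on `H^{1/2}`:
for almost every boundary point `x`, the principal value integral
`lim_{ε → 0+} ∫_{|x - y| > ε} k(x, y) φ(y) ds(y)` exists and equals `(T φ)(x)`. -/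
def IsNPOperator {a b : ℝ} (T : HHalf a b →L[ℂ] HHalf a b) : Prop :=
  ∀ φ : HHalf a b, ∀ᵐ x ∂(lineElement a b),
    Tendsto
      (fun ε : ℝ => ∫ y in {y : Plane | ε < ‖x - y‖},
        (npKernel a b x y : ℂ) * φ.toLp y ∂(lineElement a b))
      (𝓝[>] 0) (𝓝 ((T φ).toLp x))

/-- The standard parametrization traces out exactly the boundary of the elliptic domain. -/
theorem range_ellipseCurve {a b : ℝ} (ha : 0 < a) (hb : 0 < b) :
    Set.range (ellipseCurve a b) = frontier (ellipse a b) := by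
  have hc : Continuous fun x : Plane => x 0 ^ 2 / a ^ 2 + x 1 ^ 2 / b ^ 2 := by fun_prop
  have ho : IsOpen (ellipse a b) := isOpen_lt hc continuous_const
  ext x
  constructor
  · rintro ⟨t, rfl⟩
    have key : ∀ s : ℝ, (s • ellipseCurve a b t) 0 ^ 2 / a ^ 2
        + (s • ellipseCurve a b t) 1 ^ 2 / b ^ 2 = s ^ 2 := by
      intro s
      simp only [ellipseCurve, PiLp.smul_apply, smul_eq_mul]
      simp
      field_simp
      rw [Real.cos_sq_add_sin_sq, mul_one]
    rw [ho.frontier_eq]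
    refine ⟨?_, ?_⟩
    · have h1 : Tendsto (fun s : ℝ => s • ellipseCurve a b t) (𝓝[<] 1)
          (𝓝 (ellipseCurve a b t)) := by
        have : Continuous fun s : ℝ => s • ellipseCurve a b t := by fun_prop
        simpa using (this.tendsto 1).mono_left nhdsWithin_le_nhds
      refine mem_closure_of_tendsto h1 ?_
      have h2 : ∀ᶠ s : ℝ in 𝓝[<] 1, s ∈ Set.Ioo (0 : ℝ) 1 := Ioo_mem_nhdsLT one_pos
      filter_upwards [h2] with s hs
      have := key s
      simp only [ellipse, Set.mem_ofPred_eq, this]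
      nlinarith [hs.1, hs.2]
    · have := key 1
      simp only [one_smul] at this
      simp [ellipse, this]
  · intro hx
    have h : x 0 ^ 2 / a ^ 2 + x 1 ^ 2 / b ^ 2 = 1 := frontier_lt_subset_eq hc continuous_const hx
    set z : ℂ := ⟨x 0 / a, x 1 / b⟩ with hz
    have hn : ‖z‖ = 1 := by
      rw [← sq_eq_sq₀ (norm_nonneg _) zero_le_one, Complex.sq_norm, Complex.normSq_apply]
      simp only [hz]
      rw [one_pow, ← h]
      ring
    refine ⟨z.arg, ?_⟩
    have h0 : z ≠ 0 := by
      intro h0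
      simp [h0] at hn
    ext i
    fin_cases i
    · have : Real.cos z.arg = x 0 / a := by rw [Complex.cos_arg h0, hn, div_one]
      simp only [ellipseCurve, this]
      simp
      field_simp
    · have : Real.sin z.arg = x 1 / b := by rw [Complex.sin_arg, hn, div_one]
      simp only [ellipseCurve, this]
      simp
      field_simp

end

/-!
Let `r = (a - b) / (a + b)`. In the parametrization `t ↦ (a cos t, b sin t)` the Neumann–Poincaré
kernel times the line element is `P (cos (s + t))`, where `4π P` is the Poisson kernel of the unit
disk at radius `r`. Being smooth, this kernel defines an operator `S` from `L²(0, 2π)` to `H^{1/2}`,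
and the Neumann–Poincaré operator is `S J`, where `J` pulls functions on the ellipse back to the
parameter interval. The operators `S J` and `J S` have the same nonzero spectrum, and `J S` lives on
`L²(0, 2π)`, where it is self-adjoint and, by the Schur test, of norm at most `1 / 2`. By the
Poisson integral formula, `cos (n t)` and `sin (n t)` are eigenfunctions of `J S` with eigenvalues
`r ^ n / 2` and `-r ^ n / 2`. As `b / a → 0` we have `r → 1`, and consecutive powers of `r` differ
by at most `1 - r`, so the eigenvalues become dense in `[-1 / 2, 1 / 2]`.
-/

noncomputable section

section Spectrum

variable {𝕜 E F : Type*} [Field 𝕜] [TopologicalSpace E] [AddCommGroup E] [Module 𝕜 E]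
  [IsTopologicalAddGroup E] [ContinuousConstSMul 𝕜 E] [TopologicalSpace F] [AddCommGroup F]
  [Module 𝕜 F] [IsTopologicalAddGroup F] [ContinuousConstSMul 𝕜 F]

theorem mem_spectrum_comp_of_mem_spectrum_comp (S : F →L[𝕜] E) (J : E →L[𝕜] F) {z : 𝕜}
    (hz : z ≠ 0) (h : z ∈ spectrum 𝕜 (S ∘L J)) : z ∈ spectrum 𝕜 (J ∘L S) := by
  rw [spectrum.mem_iff] at h ⊢
  contrapose! h
  obtain ⟨R, hR, hR'⟩ := isUnit_iff_exists.1 h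
  have left_resolvent (x : F) : z⁻¹ • (x + J (S (R x))) = R x := by
    rw [inv_smul_eq_iff₀ hz, ← eq_sub_iff_add_eq]
    simpa [Algebra.algebraMap_eq_smul_one] using (DFunLike.congr_fun hR x).symm
  have right_resolvent (x : F) : z⁻¹ • (x + R (J (S x))) = R x := by
    rw [inv_smul_eq_iff₀ hz, ← eq_sub_iff_add_eq]
    simpa [Algebra.algebraMap_eq_smul_one] using (DFunLike.congr_fun hR' x).symm
  refine isUnit_iff_exists.2 ⟨z⁻¹ • (1 + S ∘L R ∘L J), ?_, ?_⟩
  · ext x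
    have h := congrArg S (left_resolvent (J x))
    simp only [map_smul, map_add, smul_add] at h
    simp [Algebra.algebraMap_eq_smul_one, smul_smul, hz, h]
  · ext x
    have h := congrArg S (right_resolvent (J x))
    simp only [map_smul, map_add, smul_add] at h
    simp [Algebra.algebraMap_eq_smul_one, smul_smul, hz, ← h, smul_sub]

theorem spectrum_comp_sdiff_zero_comm (S : F →L[𝕜] E) (J : E →L[𝕜] F) :
    spectrum 𝕜 (S ∘L J) \ {0} = spectrum 𝕜 (J ∘L S) \ {0} := by
  ext z
  exact ⟨fun ⟨h, hz⟩ => ⟨mem_spectrum_comp_of_mem_spectrum_comp S J hz h, hz⟩,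
    fun ⟨h, hz⟩ => ⟨mem_spectrum_comp_of_mem_spectrum_comp J S hz h, hz⟩⟩

theorem mem_spectrum_of_apply_eq_smul {T : E →L[𝕜] E} {z : 𝕜} {v : E} (hv : v ≠ 0)
    (h : T v = z • v) : z ∈ spectrum 𝕜 T := by
  intro hu
  obtain ⟨R, -, hR⟩ := isUnit_iff_exists.1 hu
  exact hv (by simpa [Algebra.algebraMap_eq_smul_one, h] using (DFunLike.congr_fun hR v).symm)

end Spectrum

section IntegralOperator

variable {𝕜 X Y : Type*} [RCLike 𝕜] [MeasurableSpace X] [MeasurableSpace Y]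

/-- A jointly measurable and bounded function `k y x`, viewed as the kernel of the integral operator
`f ↦ (y ↦ ∫ k y x f x dx)`. -/
structure IsBoundedKernel (k : Y → X → 𝕜) : Prop where
  measurable_uncurry : Measurable (Function.uncurry k)
  exists_norm_le : ∃ C, ∀ y x, ‖k y x‖ ≤ C

variable {μ : Measure X} {ν : Measure Y} {p : ENNReal} {k : Y → X → 𝕜}

theorem integral_norm_le_mul_norm [IsFiniteMeasure μ] [Fact (1 ≤ p)] (f : Lp 𝕜 p μ) :
    ∫ x, ‖f x‖ ∂μ ≤ ‖f‖ * (μ Set.univ ^ (1 - 1 / p.toReal)).toReal := by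
  have hf := Lp.aestronglyMeasurable f
  rw [integral_norm_eq_lintegral_enorm hf, ← eLpNorm_one_eq_lintegral_enorm, Lp.norm_def,
    ← ENNReal.toReal_mul]
  refine ENNReal.toReal_mono (ENNReal.mul_ne_top (Lp.eLpNorm_ne_top f) ?_) ?_
  · refine ENNReal.rpow_ne_top_of_nonneg (sub_nonneg.2 ?_) (measure_ne_top _ _)
    rw [one_div, ← ENNReal.toReal_inv]
    exact ENNReal.toReal_mono ENNReal.one_ne_top (ENNReal.inv_le_one.2 Fact.out)
  · simpa using eLpNorm_le_eLpNorm_mul_rpow_measure_univ (p := 1) (q := p) Fact.out hf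

namespace IsBoundedKernel

theorem bddAbove_norm (hk : IsBoundedKernel k) : ∃ C, 0 ≤ C ∧ ∀ y x, ‖k y x‖ ≤ C :=
  let ⟨C, hC⟩ := hk.exists_norm_le
  ⟨max C 0, le_max_right _ _, fun y x => (hC y x).trans (le_max_left _ _)⟩

theorem integrable_mul (hk : IsBoundedKernel k) {f : X → 𝕜} (hf : Integrable f μ) (y : Y) :
    Integrable (fun x => k y x * f x) μ :=
  let ⟨_, hC⟩ := hk.exists_norm_le
  hf.bdd_mul (hk.measurable_uncurry.of_uncurry_left).aestronglyMeasurable (ae_of_all _ (hC y))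

theorem integrable_uncurry_mul (hk : IsBoundedKernel k) {F : Y × X → 𝕜}
    (hF : Integrable F (ν.prod μ)) :
    Integrable (fun q : Y × X => k q.1 q.2 * F q) (ν.prod μ) :=
  let ⟨_, hC⟩ := hk.exists_norm_le
  hF.bdd_mul hk.measurable_uncurry.aestronglyMeasurable (ae_of_all _ fun q => hC q.1 q.2)

variable [IsFiniteMeasure μ] [Fact (1 ≤ p)]

theorem exists_norm_integral_mul_le (hk : IsBoundedKernel k) :
    ∃ C, 0 ≤ C ∧ ∀ (f : Lp 𝕜 p μ) y, ‖∫ x, k y x * f x ∂μ‖ ≤ C * ‖f‖ := by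
  obtain ⟨C, hC0, hC⟩ := hk.bddAbove_norm
  refine ⟨C * (μ Set.univ ^ (1 - 1 / p.toReal)).toReal, by positivity, fun f y => ?_⟩
  have hf : Integrable f μ := (Lp.memLp f).integrable Fact.out
  calc ‖∫ x, k y x * f x ∂μ‖ ≤ ∫ x, C * ‖f x‖ ∂μ := by
        refine norm_integral_le_of_norm_le (hf.norm.const_mul C) (ae_of_all _ fun x => ?_)
        rw [norm_mul]
        gcongr
        exact hC y x
    _ = C * ∫ x, ‖f x‖ ∂μ := integral_const_mul _ _
    _ ≤ C * (‖f‖ * (μ Set.univ ^ (1 - 1 / p.toReal)).toReal) := by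
        gcongr
        exact integral_norm_le_mul_norm f
    _ = _ := by ring

variable [IsFiniteMeasure ν]

theorem memLp_integral_mul (hk : IsBoundedKernel k) (f : Lp 𝕜 p μ) (q : ENNReal) :
    MemLp (fun y => ∫ x, k y x * f x ∂μ) q ν := by
  obtain ⟨C, -, hC⟩ := hk.exists_norm_integral_mul_le (μ := μ) (p := p)
  have hm : AEStronglyMeasurable (fun z : Y × X => k z.1 z.2 * f z.2) (ν.prod μ) :=
    hk.measurable_uncurry.aestronglyMeasurable.mul (Lp.aestronglyMeasurable f).comp_snd
  exact .of_bound hm.integral_prod_right' _ (ae_of_all _ (hC f))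

variable (ν) in
/-- The integral operator `f ↦ (y ↦ ∫ k y x f x dx)` with a bounded kernel `k`, as a bounded
operator between Lebesgue spaces over finite measures. -/
def integralOperator (q : ENNReal) [Fact (1 ≤ q)] (hk : IsBoundedKernel k) :
    Lp 𝕜 p μ →L[𝕜] Lp 𝕜 q ν :=
  LinearMap.mkContinuousOfExistsBound
    { toFun := fun f => (hk.memLp_integral_mul f q).toLp
      map_add' := fun f g => by
        rw [← MemLp.toLp_add, MemLp.toLp_eq_toLp_iff]
        refine ae_of_all _ fun y => ?_
        have hf := hk.integrable_mul ((Lp.memLp f).integrable Fact.out) y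
        have hg := hk.integrable_mul ((Lp.memLp g).integrable Fact.out) y
        rw [Pi.add_apply, ← integral_add hf hg]
        refine integral_congr_ae ?_
        filter_upwards [Lp.coeFn_add f g] with x hx
        rw [hx, Pi.add_apply, mul_add]
      map_smul' := fun c f => by
        rw [RingHom.id_apply, ← MemLp.toLp_const_smul, MemLp.toLp_eq_toLp_iff]
        refine ae_of_all _ fun y => ?_
        rw [Pi.smul_apply, ← integral_smul]
        refine integral_congr_ae ?_
        filter_upwards [Lp.coeFn_smul c f] with x hx
        rw [hx, Pi.smul_apply, mul_smul_comm] }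
    (by
      obtain ⟨C, hC0, hC⟩ := hk.exists_norm_integral_mul_le (μ := μ) (p := p)
      refine ⟨measureUnivNNReal ν ^ q.toReal⁻¹ * C, fun f => ?_⟩
      rw [mul_assoc]
      refine Lp.norm_le_of_ae_bound (by positivity) ?_
      filter_upwards [(hk.memLp_integral_mul f q).coeFn_toLp] with y hy
      exact hy ▸ hC f y)

theorem coeFn_integralOperator (q : ENNReal) [Fact (1 ≤ q)] (hk : IsBoundedKernel k)
    (f : Lp 𝕜 p μ) :
    hk.integralOperator ν q f =ᵐ[ν] fun y => ∫ x, k y x * f x ∂μ :=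
  (hk.memLp_integral_mul f q).coeFn_toLp

end IsBoundedKernel

end IntegralOperator

section Hilbert

variable {𝕜 E F X Y : Type*} [RCLike 𝕜] [MeasurableSpace X] [MeasurableSpace Y]
  [NormedAddCommGroup E] [InnerProductSpace 𝕜 E] [NormedAddCommGroup F] [InnerProductSpace 𝕜 F]

theorem opNorm_le_of_norm_inner_le {T : E →L[𝕜] F} {m : ℝ} (hm : 0 ≤ m)
    (h : ∀ x y, ‖inner 𝕜 y (T x)‖ ≤ m / 2 * (‖y‖ ^ 2 + ‖x‖ ^ 2)) : ‖T‖ ≤ m := by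
  refine T.opNorm_le_bound hm fun x => ?_
  rcases hm.eq_or_lt with rfl | hm'
  · simpa using h x (T x)
  have hx := h ((m : 𝕜) • x) (T x)
  rw [map_smul, inner_smul_right, inner_self_eq_norm_sq_to_K, norm_smul, norm_mul, norm_pow,
    RCLike.norm_ofReal, RCLike.norm_ofReal, abs_of_nonneg hm, abs_norm] at hx
  exact le_of_sq_le_sq (by nlinarith) (by positivity)

variable {μ : Measure X} {ν : Measure Y} {k : Y → X → 𝕜}

theorem integral_norm_sq_eq_norm_sq (f : Lp 𝕜 2 μ) : ∫ x, ‖f x‖ ^ 2 ∂μ = ‖f‖ ^ 2 := by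
  rw [norm_sq_eq_re_inner (𝕜 := 𝕜) f, L2.inner_def, ← integral_re (L2.integrable_inner f f)]
  exact integral_congr_ae (ae_of_all _ fun x => norm_sq_eq_re_inner (𝕜 := 𝕜) (f x))

theorem integrable_norm_sq (f : Lp 𝕜 2 μ) : Integrable (fun x => ‖f x‖ ^ 2) μ :=
  (memLp_two_iff_integrable_sq_norm (Lp.aestronglyMeasurable f)).1 (Lp.memLp f)

variable [IsFiniteMeasure μ] [IsFiniteMeasure ν]

theorem integrable_mul_conj_prod (f : Lp 𝕜 2 μ) (g : Lp 𝕜 2 ν) :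
    Integrable (fun z : Y × X => starRingEnd 𝕜 (g z.1) * f z.2) (ν.prod μ) :=
  ((RCLike.conjLIE.integrable_comp_iff).2 ((Lp.memLp g).integrable one_le_two)).mul_prod
    ((Lp.memLp f).integrable one_le_two)

namespace IsBoundedKernel

theorem norm (hk : IsBoundedKernel k) : IsBoundedKernel fun y x => ‖k y x‖ :=
  ⟨hk.measurable_uncurry.norm, by simpa using hk.exists_norm_le⟩

theorem inner_integralOperator (hk : IsBoundedKernel k) (f : Lp 𝕜 2 μ) (g : Lp 𝕜 2 ν) :
    inner 𝕜 g (hk.integralOperator ν 2 f)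
      = ∫ z : Y × X, k z.1 z.2 * (starRingEnd 𝕜 (g z.1) * f z.2) ∂ν.prod μ := by
  rw [integral_prod _ (hk.integrable_uncurry_mul (integrable_mul_conj_prod f g)), L2.inner_def]
  refine integral_congr_ae ?_
  filter_upwards [hk.coeFn_integralOperator 2 f] with y hy
  rw [RCLike.inner_apply, hy, ← integral_mul_const]
  exact integral_congr_ae (ae_of_all _ fun x => by ring)

theorem adjoint_integralOperator (hk : IsBoundedKernel k) {k' : X → Y → 𝕜}
    (hk' : IsBoundedKernel k') (h : ∀ x y, k' x y = starRingEnd 𝕜 (k y x)) :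
    (hk.integralOperator (μ := μ) (p := 2) ν 2).adjoint = hk'.integralOperator μ 2 := by
  refine ((ContinuousLinearMap.eq_adjoint_iff _ _).2 fun g f => ?_).symm
  rw [← inner_conj_symm, inner_integralOperator, inner_integralOperator, ← integral_conj,
    ← integral_prod_swap]
  refine integral_congr_ae (ae_of_all _ fun z => ?_)
  simp only [Prod.fst_swap, Prod.snd_swap, map_mul, h, RCLike.conj_conj]
  ring

theorem isSelfAdjoint_integralOperator {k : X → X → 𝕜} (hk : IsBoundedKernel k)
    (h : ∀ s t, k s t = starRingEnd 𝕜 (k t s)) :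
    IsSelfAdjoint (hk.integralOperator (μ := μ) (p := 2) μ 2) :=
  hk.adjoint_integralOperator hk h

theorem norm_integralOperator_le (hk : IsBoundedKernel k) {m : ℝ} (hm : 0 ≤ m)
    (hrow : ∀ y, ∫ x, ‖k y x‖ ∂μ ≤ m) (hcol : ∀ x, ∫ y, ‖k y x‖ ∂ν ≤ m) :
    ‖hk.integralOperator (μ := μ) (p := 2) ν 2‖ ≤ m := by
  refine opNorm_le_of_norm_inner_le hm fun f g => ?_
  have hg := hk.norm.integrable_uncurry_mul ((integrable_norm_sq g).comp_fst μ)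
  have hf := hk.norm.integrable_uncurry_mul ((integrable_norm_sq f).comp_snd ν)
  have hg_le : ∫ z : Y × X, ‖k z.1 z.2‖ * ‖g z.1‖ ^ 2 ∂ν.prod μ ≤ m * ‖g‖ ^ 2 := by
    rw [integral_prod _ hg, ← integral_norm_sq_eq_norm_sq, ← integral_const_mul]
    refine integral_mono hg.integral_prod_left ((integrable_norm_sq g).const_mul m) fun y => ?_
    simp only [integral_mul_const]
    gcongr
    exact hrow y
  have hf_le : ∫ z : Y × X, ‖k z.1 z.2‖ * ‖f z.2‖ ^ 2 ∂ν.prod μ ≤ m * ‖f‖ ^ 2 := by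
    rw [integral_prod_symm _ hf, ← integral_norm_sq_eq_norm_sq, ← integral_const_mul]
    refine integral_mono hf.integral_prod_right ((integrable_norm_sq f).const_mul m) fun x => ?_
    simp only [integral_mul_const]
    gcongr
    exact hcol x
  rw [inner_integralOperator]
  calc _ ≤ ∫ z : Y × X, 2⁻¹ * (‖k z.1 z.2‖ * ‖g z.1‖ ^ 2 + ‖k z.1 z.2‖ * ‖f z.2‖ ^ 2)
          ∂ν.prod μ := by
        refine norm_integral_le_of_norm_le ((hg.add hf).const_mul _) (ae_of_all _ fun z => ?_)
        rw [norm_mul, norm_mul, RCLike.norm_conj]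
        nlinarith [mul_nonneg (norm_nonneg (k z.1 z.2)) (sq_nonneg (‖g z.1‖ - ‖f z.2‖))]
    _ ≤ m / 2 * (‖g‖ ^ 2 + ‖f‖ ^ 2) := by
        rw [integral_const_mul, integral_add hg hf]
        linarith

end IsBoundedKernel

end Hilbert

section Composition

variable {𝕜 E X Y : Type*} [NormedField 𝕜] [NormedAddCommGroup E] [NormedSpace 𝕜 E]
  [MeasurableSpace X] [MeasurableSpace Y] {μ : Measure X} {ρ : Measure Y} {g : X → Y}
  {c p : ENNReal}

theorem quasiMeasurePreserving_of_map_le_smul (hg : Measurable g) (h : μ.map g ≤ c • ρ) :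
    Measure.QuasiMeasurePreserving g μ ρ :=
  ⟨hg, (Measure.absolutelyContinuous_of_le h).trans Measure.smul_absolutelyContinuous⟩

theorem memLp_comp_of_map_le_smul (hg : Measurable g) (hc : c ≠ ⊤) (h : μ.map g ≤ c • ρ)
    (f : Lp E p ρ) : MemLp (f ∘ g) p μ :=
  ((Lp.memLp f).of_measure_le_smul hc h).comp_of_map hg.aemeasurable

variable (𝕜 E p) in
/-- The composition operator `f ↦ f ∘ g` between Lebesgue spaces, bounded as soon as the
push-forward of `μ` under `g` is at most a finite multiple of `ρ`. -/
def compOperator [Fact (1 ≤ p)] (hg : Measurable g) (hc : c ≠ ⊤) (h : μ.map g ≤ c • ρ) :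
    Lp E p ρ →L[𝕜] Lp E p μ :=
  LinearMap.mkContinuous
    { toFun := fun f => (memLp_comp_of_map_le_smul hg hc h f).toLp
      map_add' := fun f₁ f₂ => by
        rw [← MemLp.toLp_add, MemLp.toLp_eq_toLp_iff]
        exact (quasiMeasurePreserving_of_map_le_smul hg h).ae_eq_comp (Lp.coeFn_add f₁ f₂)
      map_smul' := fun z f => by
        rw [RingHom.id_apply, ← MemLp.toLp_const_smul, MemLp.toLp_eq_toLp_iff]
        exact (quasiMeasurePreserving_of_map_le_smul hg h).ae_eq_comp (Lp.coeFn_smul z f) }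
    (c ^ (1 / p).toReal).toReal fun f => by
      have hf := (Lp.memLp f).of_measure_le_smul hc h
      change ‖(memLp_comp_of_map_le_smul hg hc h f).toLp‖ ≤ _
      rw [Lp.norm_toLp, Lp.norm_def, ← ENNReal.toReal_mul,
        ← eLpNorm_map_measure hf.aestronglyMeasurable hg.aemeasurable]
      exact ENNReal.toReal_mono (ENNReal.mul_ne_top
        (ENNReal.rpow_ne_top_of_nonneg ENNReal.toReal_nonneg hc) (Lp.eLpNorm_ne_top f))
        (eLpNorm_le_of_measure_le_smul h)

theorem coeFn_compOperator [Fact (1 ≤ p)] (hg : Measurable g) (hc : c ≠ ⊤) (h : μ.map g ≤ c • ρ)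
    (f : Lp E p ρ) : compOperator 𝕜 E p hg hc h f =ᵐ[μ] f ∘ g :=
  (memLp_comp_of_map_le_smul hg hc h f).coeFn_toLp

end Composition

section Sobolev

variable {X : Type*} [MeasurableSpace X] {σ : Measure Plane} {μ : Measure X} {N : Plane → X → ℂ}
  {K : NNReal}

theorem sobolevHalf_ext [SFinite σ] {φ ψ : sobolevHalf σ} (h : φ.1.fst = ψ.1.fst) : φ = ψ := by
  refine Subtype.ext (WithLp.ofLp_injective 2 (Prod.ext h (Lp.ext ?_)))
  filter_upwards [φ.2, ψ.2] with q hφ hψ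
  change φ.1.snd q = ψ.1.snd q
  rw [hφ, hψ, h]

/-- The difference quotient of a kernel `N x s` in its outer variable `x`. -/
def diffQuotient (N : Plane → X → ℂ) (q : Plane × Plane) (s : X) : ℂ :=
  (N q.1 s - N q.2 s) / (‖q.1 - q.2‖ : ℂ)

theorem IsBoundedKernel.diffQuotient (hN : IsBoundedKernel N)
    (hL : ∀ s, LipschitzWith K fun x => N x s) : IsBoundedKernel (diffQuotient N) where
  measurable_uncurry := by
    have h₁ : Measurable fun z : (Plane × Plane) × X => N z.1.1 z.2 :=
      hN.measurable_uncurry.comp (by fun_prop : Measurable fun z : (Plane × Plane) × X =>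
        (z.1.1, z.2))
    have h₂ : Measurable fun z : (Plane × Plane) × X => N z.1.2 z.2 :=
      hN.measurable_uncurry.comp (by fun_prop : Measurable fun z : (Plane × Plane) × X =>
        (z.1.2, z.2))
    exact (h₁.sub h₂).div (by fun_prop)
  exists_norm_le := ⟨K, fun q s => by
    change ‖(N q.1 s - N q.2 s) / (‖q.1 - q.2‖ : ℂ)‖ ≤ K
    rw [norm_div, Complex.norm_real, norm_norm]
    exact div_le_of_le_mul₀ (norm_nonneg _) K.2 ((hL s).norm_sub_le _ _)⟩

variable [IsFiniteMeasure σ] [IsFiniteMeasure μ]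

theorem integralOperator_diffQuotient (hN : IsBoundedKernel N)
    (hL : ∀ s, LipschitzWith K fun x => N x s) (f : Lp ℂ 2 μ) :
    ∀ᵐ q ∂σ.prod σ, (hN.diffQuotient hL).integralOperator (σ.prod σ) 2 f q =
      (hN.integralOperator σ 2 f q.1 - hN.integralOperator σ 2 f q.2) / (‖q.1 - q.2‖ : ℂ) := by
  have hf : Integrable f μ := (Lp.memLp f).integrable one_le_two
  have hσ := hN.coeFn_integralOperator (ν := σ) 2 f
  filter_upwards [(hN.diffQuotient hL).coeFn_integralOperator 2 f,
    Measure.quasiMeasurePreserving_fst.ae hσ, Measure.quasiMeasurePreserving_snd.ae hσ]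
    with q hq h₁ h₂
  rw [hq, h₁, h₂, ← integral_sub (hN.integrable_mul hf _) (hN.integrable_mul hf _),
    ← integral_div]
  exact integral_congr_ae (ae_of_all _ fun s => by simp only [diffQuotient]; ring)

variable (σ μ) in
/-- The integral operator with a bounded kernel that is Lipschitz in the outer variable, as a
bounded operator from `L²` to `H^{1/2}`. -/
def smoothingOperator (hN : IsBoundedKernel N) (hL : ∀ s, LipschitzWith K fun x => N x s) :
    Lp ℂ 2 μ →L[ℂ] sobolevHalf σ :=
  ((WithLp.prodContinuousLinearEquiv 2 ℂ (Lp ℂ 2 σ) (Lp ℂ 2 (σ.prod σ))).symm ∘L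
    (hN.integralOperator σ 2).prod ((hN.diffQuotient hL).integralOperator (σ.prod σ) 2)).codRestrict
    (sobolevHalf σ) (integralOperator_diffQuotient hN hL)

theorem coeFn_smoothingOperator (hN : IsBoundedKernel N)
    (hL : ∀ s, LipschitzWith K fun x => N x s) (f : Lp ℂ 2 μ) :
    (smoothingOperator σ μ hN hL f).1.fst =ᵐ[σ] fun x => ∫ s, N x s * f s ∂μ :=
  hN.coeFn_integralOperator 2 f

end Sobolev

section Poisson

open Real

/-- The profile `P` of the Neumann–Poincaré kernel of an ellipse with third flattening
`r = (a - b) / (a + b)`: the kernel is `P (cos (s + t))` in the angular parameters `s`, `t`. It is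
`1 / (4π)` times the Poisson kernel of the unit disk at radius `r`. -/
def npProfile (r c : ℝ) : ℝ := (1 - r ^ 2) / (4 * π * (1 - 2 * r * c + r ^ 2))

variable {r : ℝ}

theorem npProfile_denom_pos (hr : |r| < 1) {c : ℝ} (hc : c ∈ Set.Icc (-1) 1) :
    0 < 1 - 2 * r * c + r ^ 2 := by
  have hrc : r * c ≤ |r| := (le_abs_self _).trans <| by
    rw [abs_mul]
    exact mul_le_of_le_one_right (abs_nonneg r) (abs_le.2 hc)
  nlinarith [sq_abs r]

theorem npProfile_nonneg (hr : |r| < 1) {c : ℝ} (hc : c ∈ Set.Icc (-1) 1) : 0 ≤ npProfile r c := by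
  have hden := npProfile_denom_pos hr hc
  have hnum : 0 ≤ 1 - r ^ 2 := sub_nonneg.2 ((sq_le_one_iff_abs_le_one r).2 hr.le)
  rw [npProfile]
  positivity

theorem contDiffOn_npProfile (hr : |r| < 1) : ContDiffOn ℝ 1 (npProfile r) (Set.Icc (-1) 1) := by
  refine contDiffOn_const.div (by fun_prop) fun c hc => ?_
  have := npProfile_denom_pos hr hc
  positivity

theorem exists_norm_npProfile_le (hr : |r| < 1) :
    ∃ C, ∀ c ∈ Set.Icc (-1 : ℝ) 1, ‖npProfile r c‖ ≤ C :=
  isCompact_Icc.exists_bound_of_continuousOn (contDiffOn_npProfile hr).continuousOn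

theorem poissonKernel_circleMap (r s t : ℝ) :
    poissonKernel 0 (circleMap 0 r (-t)) (circleMap 0 1 s) = 4 * π * npProfile r (cos (s + t)) := by
  have hden : ‖circleMap 0 1 s - circleMap 0 r (-t)‖ ^ 2 = 1 - 2 * r * cos (s + t) + r ^ 2 := by
    rw [Complex.sq_norm, Complex.normSq_apply, cos_add]
    simp only [circleMap, zero_add, Complex.ofReal_one, one_mul, Complex.sub_re, Complex.sub_im,
      Complex.exp_ofReal_mul_I_re, Complex.exp_ofReal_mul_I_im, Complex.re_ofReal_mul,
      Complex.im_ofReal_mul, cos_neg, sin_neg]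
    linear_combination sin_sq_add_cos_sq s + r ^ 2 * sin_sq_add_cos_sq t
  rw [poissonKernel_def, sub_zero, sub_zero, hden, npProfile, norm_circleMap_zero,
    norm_circleMap_zero, abs_one, sq_abs, one_pow, mul_div, mul_div_mul_left _ _ (by positivity)]

theorem re_circleMap_pow_mul_exp (r s θ : ℝ) (n : ℕ) :
    (circleMap 0 r s ^ n * Complex.exp (-θ * Complex.I)).re = r ^ n * cos (n * s - θ) := by
  rw [circleMap_zero, mul_pow, ← Complex.exp_nat_mul, mul_assoc, ← Complex.exp_add,
    ← Complex.ofReal_pow, Complex.re_ofReal_mul, ← Complex.exp_ofReal_mul_I_re]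
  push_cast
  ring_nf

/-- The Poisson integral formula for the harmonic function `Re (exp (-iθ) z ^ n)` at the point
`r exp (-it)`. -/
theorem integral_npProfile_mul_cos (hr : |r| < 1) (n : ℕ) (θ t : ℝ) :
    ∫ s in Set.Ioc 0 (2 * π), npProfile r (cos (s + t)) * cos (n * s - θ)
      = r ^ n / 2 * cos (n * t + θ) := by
  have harmonic : InnerProductSpace.HarmonicOnNhd
      (fun z : ℂ => (z ^ n * Complex.exp (-θ * Complex.I)).re) (Metric.closedBall 0 1) :=
    fun z _ => AnalyticAt.harmonicAt_re (f := fun z => z ^ n * Complex.exp (-θ * Complex.I))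
      (by fun_prop)
  have formula := harmonic.circleAverage_poissonKernel_smul (w := circleMap 0 r (-t)) (by simpa)
  simp only [circleAverage_def, smul_eq_mul, Pi.mul_apply, poissonKernel_circleMap,
    re_circleMap_pow_mul_exp, one_pow, one_mul, mul_assoc (4 * π),
    intervalIntegral.integral_const_mul] at formula
  have normalization : (2 * π)⁻¹ * (4 * π) = 2 := by
    field_simp
    norm_num
  rw [← mul_assoc, normalization] at formula
  rw [← intervalIntegral.integral_of_le (by positivity), ← cos_neg, neg_add', neg_mul_eq_mul_neg]
  linear_combination formula / 2

end Poisson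

section ReducedOperator

open Real

variable {r : ℝ}

theorem isBoundedKernel_npProfile {X Y : Type*} [MeasurableSpace X] [MeasurableSpace Y]
    (hr : |r| < 1) {u : Y → X → ℝ} (hu : Measurable (Function.uncurry u))
    (hmem : ∀ y x, u y x ∈ Set.Icc (-1) 1) :
    IsBoundedKernel fun y x => (npProfile r (u y x) : ℂ) where
  measurable_uncurry := by
    have hP : Measurable (npProfile r) := by unfold npProfile; fun_prop
    exact Complex.measurable_ofReal.comp (hP.comp hu)
  exists_norm_le :=
    let ⟨C, hC⟩ := exists_norm_npProfile_le hr
    ⟨C, fun y x => by simpa only [Complex.norm_real] using hC _ (hmem y x)⟩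

theorem isBoundedKernel_npProfile_cos_add (hr : |r| < 1) :
    IsBoundedKernel fun t s : ℝ => (npProfile r (cos (s + t)) : ℂ) :=
  isBoundedKernel_npProfile hr
    (by fun_prop : Continuous fun q : ℝ × ℝ => cos (q.2 + q.1)).measurable
    fun t s => cos_mem_Icc (s + t)

/-- Lebesgue measure on the parameter interval `(0, 2π]` of an ellipse. -/
abbrev angleMeasure : Measure ℝ := volume.restrict (Set.Ioc 0 (2 * π))

/-- The Neumann–Poincaré operator of an ellipse in the angular parameter, acting on
`L²(0, 2π)`. -/
def npAngleOperator (hr : |r| < 1) : Lp ℂ 2 angleMeasure →L[ℂ] Lp ℂ 2 angleMeasure :=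
  (isBoundedKernel_npProfile_cos_add hr).integralOperator angleMeasure 2

theorem isSelfAdjoint_npAngleOperator (hr : |r| < 1) : IsSelfAdjoint (npAngleOperator hr) :=
  IsBoundedKernel.isSelfAdjoint_integralOperator _ fun s t => by
    rw [Complex.conj_ofReal, add_comm]

theorem integral_norm_npProfile_cos_add (hr : |r| < 1) (t : ℝ) :
    ∫ s, ‖(npProfile r (cos (s + t)) : ℂ)‖ ∂angleMeasure = 1 / 2 := by
  simp_rw [Complex.norm_real, norm_of_nonneg (npProfile_nonneg hr (cos_mem_Icc _))]
  simpa using integral_npProfile_mul_cos hr 0 0 t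

theorem norm_npAngleOperator_le (hr : |r| < 1) : ‖npAngleOperator hr‖ ≤ 1 / 2 :=
  IsBoundedKernel.norm_integralOperator_le _ one_half_pos.le
    (fun t => (integral_norm_npProfile_cos_add hr t).le)
    fun s => by simpa only [add_comm] using (integral_norm_npProfile_cos_add hr s).le

theorem spectrum_npAngleOperator_subset (hr : |r| < 1) :
    spectrum ℂ (npAngleOperator hr) ⊆ (fun t : ℝ => (t : ℂ)) '' Set.Icc (-(1 / 2)) (1 / 2) := by
  intro z hz
  have norm_le : ‖z‖ ≤ 1 / 2 :=
    calc ‖z‖ ≤ ‖npAngleOperator hr‖ * ‖(1 : Lp ℂ 2 angleMeasure →L[ℂ] Lp ℂ 2 angleMeasure)‖ :=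
          spectrum.norm_le_norm_mul_of_mem hz
      _ ≤ 1 / 2 * 1 := mul_le_mul (norm_npAngleOperator_le hr) ContinuousLinearMap.norm_id_le
          (norm_nonneg _) one_half_pos.le
      _ = 1 / 2 := mul_one _
  exact ⟨z.re, abs_le.1 ((Complex.abs_re_le_norm z).trans norm_le),
    ((isSelfAdjoint_npAngleOperator hr).mem_spectrum_eq_re hz).symm⟩

theorem memLp_cos (n : ℕ) (θ : ℝ) :
    MemLp (fun s : ℝ => (cos (n * s - θ) : ℂ)) 2 angleMeasure := by
  refine .of_bound (Continuous.aestronglyMeasurable (by fun_prop)) 1 (ae_of_all _ fun s => ?_)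
  rw [Complex.norm_real]
  exact abs_cos_le_one _

theorem npAngleOperator_cos (hr : |r| < 1) (n : ℕ) (θ : ℝ) :
    npAngleOperator hr (memLp_cos n θ).toLp
      =ᵐ[angleMeasure] fun t => ((r ^ n / 2 * cos (n * t + θ) : ℝ) : ℂ) := by
  filter_upwards [(isBoundedKernel_npProfile_cos_add hr).coeFn_integralOperator 2
    (memLp_cos n θ).toLp] with t ht
  rw [npAngleOperator, ht, ← integral_npProfile_mul_cos hr, ← integral_complex_ofReal]
  refine integral_congr_ae ?_
  filter_upwards [(memLp_cos n θ).coeFn_toLp] with s hs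
  rw [hs, Complex.ofReal_mul]

theorem toLp_cos_ne_zero {n : ℕ} {θ s₀ : ℝ} (hs₀ : s₀ ∈ Set.Ioc 0 (2 * π))
    (h : cos (n * s₀ - θ) ≠ 0) : (memLp_cos n θ).toLp ≠ 0 := by
  intro h0
  have heq := (memLp_cos n θ).coeFn_toLp.symm.trans (h0 ▸ Lp.coeFn_zero ℂ 2 angleMeasure)
  exact h (Complex.ofReal_eq_zero.1 (Measure.eqOn_Ioc_of_ae_eq volume heq
    (Continuous.continuousOn (by fun_prop)) continuousOn_const hs₀))

theorem mem_spectrum_npAngleOperator (hr : |r| < 1) {n : ℕ} {θ e s₀ : ℝ}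
    (hs₀ : s₀ ∈ Set.Ioc 0 (2 * π)) (hne : cos (n * s₀ - θ) ≠ 0)
    (hθ : ∀ t, cos (n * t + θ) = e * cos (n * t - θ)) :
    ((e * (r ^ n / 2) : ℝ) : ℂ) ∈ spectrum ℂ (npAngleOperator hr) := by
  refine mem_spectrum_of_apply_eq_smul (toLp_cos_ne_zero hs₀ hne) (Lp.ext ?_)
  filter_upwards [npAngleOperator_cos hr n θ, (memLp_cos n θ).coeFn_toLp,
    Lp.coeFn_smul ((e * (r ^ n / 2) : ℝ) : ℂ) (memLp_cos n θ).toLp] with t h₁ h₂ h₃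
  rw [h₁, h₃, Pi.smul_apply, h₂, smul_eq_mul, ← Complex.ofReal_mul, hθ]
  ring_nf

theorem pow_div_two_mem_spectrum_npAngleOperator (hr : |r| < 1) (n : ℕ) :
    ((r ^ n / 2 : ℝ) : ℂ) ∈ spectrum ℂ (npAngleOperator hr) := by
  rw [← one_mul (r ^ n / 2)]
  exact mem_spectrum_npAngleOperator hr (θ := 0) ⟨two_pi_pos, le_rfl⟩
    (by rw [sub_zero, cos_nat_mul_two_pi]; exact one_ne_zero) fun t => by simp

theorem neg_pow_div_two_mem_spectrum_npAngleOperator (hr : |r| < 1) (n : ℕ) :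
    ((-(r ^ (n + 1) / 2) : ℝ) : ℂ) ∈ spectrum ℂ (npAngleOperator hr) := by
  rw [← neg_one_mul]
  refine mem_spectrum_npAngleOperator hr (θ := π / 2) (s₀ := π / 2 / (n + 1))
    ⟨by positivity, ?_⟩ ?_ fun t => by
      rw [cos_add_pi_div_two, cos_sub_pi_div_two, neg_one_mul]
  · rw [div_le_iff₀ (by positivity)]
    nlinarith [mul_nonneg pi_nonneg n.cast_nonneg, pi_pos]
  · rw [Nat.cast_succ, mul_div_cancel₀ _ (by positivity), sub_self, cos_zero]
    exact one_ne_zero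

end ReducedOperator

section Ellipse

open Real

variable {a b : ℝ}

theorem continuous_ellipseCurve (a b : ℝ) : Continuous (ellipseCurve a b) := by
  unfold ellipseCurve
  fun_prop

theorem ellipseCurve_apply_zero (a b t : ℝ) : ellipseCurve a b t 0 = a * cos t := rfl

theorem ellipseCurve_apply_one (a b t : ℝ) : ellipseCurve a b t 1 = b * sin t := rfl

theorem deriv_ellipseCurve (a b t : ℝ) :
    deriv (ellipseCurve a b) t = !₂[-(a * sin t), b * cos t] := by
  have h : HasDerivAt (fun t i => (![a * cos t, b * sin t] : Fin 2 → ℝ) i)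
      ![-(a * sin t), b * cos t] t := by
    refine hasDerivAt_pi.2 fun i => ?_
    fin_cases i
    · simpa using (hasDerivAt_cos t).const_mul a
    · simpa using (hasDerivAt_sin t).const_mul b
  exact ((EuclideanSpace.equiv (Fin 2) ℝ).symm.hasFDerivAt.comp_hasDerivAt t h).deriv

theorem norm_deriv_ellipseCurve (a b t : ℝ) :
    ‖deriv (ellipseCurve a b) t‖ = √(a ^ 2 * sin t ^ 2 + b ^ 2 * cos t ^ 2) := by
  rw [deriv_ellipseCurve, EuclideanSpace.norm_eq]
  simp [Fin.sum_univ_two, mul_pow]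

theorem continuous_norm_deriv_ellipseCurve (a b : ℝ) :
    Continuous fun t => ‖deriv (ellipseCurve a b) t‖ := by
  simp_rw [norm_deriv_ellipseCurve]
  fun_prop

theorem min_le_norm_deriv_ellipseCurve (ha : 0 ≤ a) (hb : 0 ≤ b) (t : ℝ) :
    min a b ≤ ‖deriv (ellipseCurve a b) t‖ := by
  rw [norm_deriv_ellipseCurve]
  refine le_sqrt_of_sq_le ?_
  calc min a b ^ 2 = min a b ^ 2 * sin t ^ 2 + min a b ^ 2 * cos t ^ 2 := by
        rw [← mul_add, sin_sq_add_cos_sq, mul_one]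
    _ ≤ a ^ 2 * sin t ^ 2 + b ^ 2 * cos t ^ 2 := by
        gcongr
        exacts [min_le_left a b, min_le_right a b]

theorem norm_ellipseCurve_sub_sq (a b s t : ℝ) :
    ‖ellipseCurve a b t - ellipseCurve a b s‖ ^ 2
      = (1 - cos (s - t)) * (a ^ 2 + b ^ 2 - (a ^ 2 - b ^ 2) * cos (s + t)) := by
  have coordinates : ‖ellipseCurve a b t - ellipseCurve a b s‖ ^ 2
      = a ^ 2 * (cos t - cos s) ^ 2 + b ^ 2 * (sin t - sin s) ^ 2 := by
    rw [EuclideanSpace.norm_sq_eq, Fin.sum_univ_two]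
    simp only [PiLp.sub_apply, ellipseCurve_apply_zero, ellipseCurve_apply_one, norm_eq_abs,
      sq_abs]
    ring
  have hs := sin_sq s
  have ht := sin_sq t
  rw [coordinates, cos_sub, cos_add]
  grind

theorem norm_deriv_smul_outwardNormal (ha : 0 < a) (hb : 0 < b) (s : ℝ) :
    ‖deriv (ellipseCurve a b) s‖ • outwardNormal a b (ellipseCurve a b s)
      = !₂[b * cos s, a * sin s] := by
  have gradient : (!₂[(ellipseCurve a b s) 0 / a ^ 2, (ellipseCurve a b s) 1 / b ^ 2] : Plane)
      = (a * b)⁻¹ • !₂[b * cos s, a * sin s] := by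
    rw [ellipseCurve_apply_zero, ellipseCurve_apply_one]
    ext i
    fin_cases i <;>
      simp only [PiLp.smul_apply, smul_eq_mul, Fin.zero_eta, Fin.mk_one, Matrix.cons_val_zero,
        Matrix.cons_val_one] <;>
      field_simp
  have norm_gradient : ‖(!₂[b * cos s, a * sin s] : Plane)‖ = ‖deriv (ellipseCurve a b) s‖ := by
    rw [norm_deriv_ellipseCurve, EuclideanSpace.norm_eq]
    simp [Fin.sum_univ_two, mul_pow, add_comm]
  have speed_ne_zero : ‖deriv (ellipseCurve a b) s‖ ≠ 0 :=
    ((lt_min ha hb).trans_le (min_le_norm_deriv_ellipseCurve ha.le hb.le s)).ne'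
  rw [outwardNormal, gradient, norm_smul, norm_gradient, norm_of_nonneg (by positivity),
    smul_smul, smul_smul, mul_inv, inv_inv, mul_assoc, mul_right_comm,
    mul_inv_cancel₀ (mul_pos ha hb).ne', one_mul, mul_inv_cancel₀ speed_ne_zero, one_smul]

/-- The third flattening of the ellipse with semi-axes `a` and `b`. -/
def thirdFlattening (a b : ℝ) : ℝ := (a - b) / (a + b)

theorem abs_thirdFlattening_lt_one (ha : 0 < a) (hb : 0 < b) : |thirdFlattening a b| < 1 := by
  rw [thirdFlattening, abs_div, abs_of_pos (add_pos ha hb), div_lt_one (add_pos ha hb), abs_lt]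
  constructor <;> linarith

theorem npProfile_thirdFlattening (h : a + b ≠ 0) (c : ℝ) :
    npProfile (thirdFlattening a b) c
      = a * b / (2 * π * (a ^ 2 + b ^ 2 - (a ^ 2 - b ^ 2) * c)) := by
  have hnum : (a + b) ^ 2 * (1 - thirdFlattening a b ^ 2) = 4 * (a * b) := by
    rw [thirdFlattening]
    field_simp
    ring
  have hden : (a + b) ^ 2 * (4 * π * (1 - 2 * thirdFlattening a b * c + thirdFlattening a b ^ 2))
      = 4 * (2 * π * (a ^ 2 + b ^ 2 - (a ^ 2 - b ^ 2) * c)) := by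
    rw [thirdFlattening]
    field_simp
    ring
  rw [npProfile, ← mul_div_mul_left _ _ (pow_ne_zero 2 h), hnum, hden,
    mul_div_mul_left _ _ four_ne_zero]

theorem norm_deriv_mul_npKernel (ha : 0 < a) (hb : 0 < b) {s t : ℝ} (hst : cos (s - t) ≠ 1) :
    ‖deriv (ellipseCurve a b) s‖ * npKernel a b (ellipseCurve a b t) (ellipseCurve a b s)
      = npProfile (thirdFlattening a b) (cos (s + t)) := by
  have normal_component : ‖deriv (ellipseCurve a b) s‖ * inner ℝ
      (ellipseCurve a b s - ellipseCurve a b t) (outwardNormal a b (ellipseCurve a b s))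
        = (1 - cos (s - t)) * (a * b) := by
    rw [← real_inner_smul_right, norm_deriv_smul_outwardNormal ha hb, PiLp.inner_apply,
      Fin.sum_univ_two, cos_sub]
    simp only [PiLp.sub_apply, ellipseCurve_apply_zero, ellipseCurve_apply_one,
      Matrix.cons_val_zero, Matrix.cons_val_one, RCLike.inner_apply, conj_trivial]
    linear_combination a * b * sin_sq_add_cos_sq s
  rw [npKernel, npProfile_thirdFlattening (add_pos ha hb).ne', mul_left_comm, ← mul_div_assoc,
    normal_component, norm_ellipseCurve_sub_sq, mul_div_mul_left _ _ (sub_ne_zero.2 hst.symm),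
    div_mul_div_comm, one_mul]

theorem ae_cos_sub_ne_one (t : ℝ) : ∀ᵐ s : ℝ, cos (s - t) ≠ 1 := by
  have hsub : {s : ℝ | cos (s - t) = 1} ⊆ Set.range fun n : ℤ => n * (2 * π) + t := fun s hs =>
    let ⟨n, hn⟩ := (cos_eq_one_iff _).1 hs
    ⟨n, eq_sub_iff_add_eq.1 hn⟩
  exact measure_eq_zero_iff_ae_notMem.1
    (measure_mono_null hsub ((Set.countable_range _).measure_zero volume))

end Ellipse

section LineElement

open Real

variable {a b : ℝ}

instance isFiniteMeasure_lineElement (a b : ℝ) : IsFiniteMeasure (lineElement a b) := by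
  have := isFiniteMeasure_withDensity_ofReal (μ := angleMeasure)
    (continuous_norm_deriv_ellipseCurve a b).integrableOn_Ioc.hasFiniteIntegral
  unfold lineElement
  infer_instance

theorem map_ellipseCurve_le_smul_lineElement (ha : 0 < a) (hb : 0 < b) :
    angleMeasure.map (ellipseCurve a b) ≤ ENNReal.ofReal (min a b)⁻¹ • lineElement a b := by
  have hmin := lt_min ha hb
  rw [lineElement, ← Measure.map_smul]
  refine Measure.map_mono ?_ (continuous_ellipseCurve a b).measurable
  rw [← withDensity_smul _ (continuous_norm_deriv_ellipseCurve a b).measurable.ennreal_ofReal]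
  nth_rewrite 1 [← withDensity_one (μ := angleMeasure)]
  refine withDensity_mono (ae_of_all _ fun t => ?_)
  rw [Pi.smul_apply, smul_eq_mul, ← ENNReal.ofReal_mul (by positivity), Pi.one_apply,
    ENNReal.one_le_ofReal, inv_mul_eq_div, one_le_div hmin]
  exact min_le_norm_deriv_ellipseCurve ha.le hb.le t

theorem ae_lineElement_mem_range (ha : 0 < a) (hb : 0 < b) :
    ∀ᵐ x ∂lineElement a b, x ∈ Set.range (ellipseCurve a b) := by
  have hm : MeasurableSet (Set.range (ellipseCurve a b)) := by
    rw [range_ellipseCurve ha hb]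
    exact isClosed_frontier.measurableSet
  exact (ae_map_iff (continuous_ellipseCurve a b).aemeasurable hm).2
    (ae_of_all _ Set.mem_range_self)

variable {E : Type*} [NormedAddCommGroup E] [NormedSpace ℝ E] {F : Plane → E}

theorem integral_lineElement (hF : AEStronglyMeasurable F (lineElement a b)) :
    ∫ y, F y ∂lineElement a b
      = ∫ s, ‖deriv (ellipseCurve a b) s‖ • F (ellipseCurve a b s) ∂angleMeasure := by
  rw [lineElement, integral_map (continuous_ellipseCurve a b).aemeasurable hF,
    integral_withDensity_eq_integral_toReal_smul
      (continuous_norm_deriv_ellipseCurve a b).measurable.ennreal_ofReal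
      (ae_of_all _ fun _ => ENNReal.ofReal_lt_top)]
  simp only [ENNReal.toReal_ofReal (norm_nonneg _)]

theorem integrable_lineElement_iff (hF : AEStronglyMeasurable F (lineElement a b)) :
    Integrable F (lineElement a b) ↔
      Integrable (fun s => ‖deriv (ellipseCurve a b) s‖ • F (ellipseCurve a b s)) angleMeasure := by
  rw [lineElement, integrable_map_measure hF (continuous_ellipseCurve a b).aemeasurable,
    integrable_withDensity_iff_integrable_smul'
      (continuous_norm_deriv_ellipseCurve a b).measurable.ennreal_ofReal
      (ae_of_all _ fun _ => ENNReal.ofReal_lt_top)]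
  simp only [ENNReal.toReal_ofReal (norm_nonneg _), Function.comp_apply]

end LineElement

section SmoothKernel

open Real

variable {a b : ℝ}

theorem lipschitzWith_coord_mul {ι : Type*} [Fintype ι] (i : ι) {c : ℝ} {K : NNReal}
    (hc : ‖c‖ ≤ K) : LipschitzWith K fun x : EuclideanSpace ℝ ι => x i * c :=
  .of_dist_le_mul fun x y => by
    rw [dist_eq_norm, dist_eq_norm, ← sub_mul, norm_mul, mul_comm]
    gcongr
    exact PiLp.norm_apply_le (x - y) i

theorem lipschitzWith_coord_mul_cos_sub_coord_mul_sin (a b s : ℝ) :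
    LipschitzWith (‖a‖₊⁻¹ + ‖b‖₊⁻¹) fun x : Plane => x 0 * (cos s / a) - x 1 * (sin s / b) := by
  refine (lipschitzWith_coord_mul 0 ?_).sub (lipschitzWith_coord_mul 1 ?_)
  · rw [norm_div, div_eq_inv_mul]
    exact mul_le_of_le_one_right (by positivity) (abs_cos_le_one s)
  · rw [norm_div, div_eq_inv_mul]
    exact mul_le_of_le_one_right (by positivity) (abs_sin_le_one s)

/-- The Neumann–Poincaré kernel times the line element, as a function of a point `x` of the plane
and the parameter `s` of a boundary point. At `x = (a cos t, b sin t)` the clamped argument is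
`cos (s + t)`; clamping it to `[-1, 1]` makes the kernel bounded and Lipschitz off the ellipse. -/
def npSmoothKernel (a b : ℝ) (x : Plane) (s : ℝ) : ℂ :=
  (npProfile (thirdFlattening a b)
    (Set.projIcc (-1) 1 (neg_le_self zero_le_one) (x 0 * (cos s / a) - x 1 * (sin s / b))) : ℝ)

theorem npSmoothKernel_ellipseCurve (ha : a ≠ 0) (hb : b ≠ 0) (s t : ℝ) :
    npSmoothKernel a b (ellipseCurve a b t) s
      = npProfile (thirdFlattening a b) (cos (s + t)) := by
  have argument : ellipseCurve a b t 0 * (cos s / a) - ellipseCurve a b t 1 * (sin s / b)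
      = cos (s + t) := by
    rw [ellipseCurve_apply_zero, ellipseCurve_apply_one, cos_add]
    field_simp
  rw [npSmoothKernel, argument, Set.projIcc_of_mem _ (cos_mem_Icc _)]

theorem isBoundedKernel_npSmoothKernel (ha : 0 < a) (hb : 0 < b) :
    IsBoundedKernel (npSmoothKernel a b) :=
  isBoundedKernel_npProfile (abs_thirdFlattening_lt_one ha hb)
    (Continuous.measurable <| continuous_subtype_val.comp <| continuous_projIcc.comp <| by fun_prop)
    fun _ _ => Subtype.coe_prop _

theorem exists_lipschitzWith_npSmoothKernel (ha : 0 < a) (hb : 0 < b) :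
    ∃ K : NNReal, ∀ s, LipschitzWith K fun x => npSmoothKernel a b x s := by
  obtain ⟨K, hK⟩ := (contDiffOn_npProfile
    (abs_thirdFlattening_lt_one ha hb)).exists_lipschitzOnWith one_ne_zero (convex_Icc _ _)
    isCompact_Icc
  exact ⟨_, fun s => Complex.isometry_ofReal.lipschitz.comp (hK.to_restrict.comp
    ((LipschitzWith.projIcc _).comp (lipschitzWith_coord_mul_cos_sub_coord_mul_sin a b s)))⟩

theorem measurable_npKernel (a b : ℝ) (x : Plane) : Measurable (npKernel a b x) := by
  have hgrad : Measurable fun y : Plane => (!₂[y 0 / a ^ 2, y 1 / b ^ 2] : Plane) :=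
    Continuous.measurable (by fun_prop)
  have hnormal : Measurable (outwardNormal a b) := hgrad.norm.inv.smul hgrad
  exact (((measurable_id.sub_const x).inner hnormal).div (by fun_prop)).const_mul _

end SmoothKernel

section NPOperator

open Real

variable {a b : ℝ}

theorem aestronglyMeasurable_npKernel_mul (x : Plane) (f : Lp ℂ 2 (lineElement a b)) :
    AEStronglyMeasurable (fun y => (npKernel a b x y : ℂ) * f y) (lineElement a b) :=
  (Complex.measurable_ofReal.comp (measurable_npKernel a b x)).aestronglyMeasurable.mul
    (Lp.aestronglyMeasurable f)

/-- The pull-back of functions on the boundary of an ellipse to the parameter interval. -/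
def pullback (ha : 0 < a) (hb : 0 < b) : Lp ℂ 2 (lineElement a b) →L[ℂ] Lp ℂ 2 angleMeasure :=
  compOperator ℂ ℂ 2 (continuous_ellipseCurve a b).measurable ENNReal.ofReal_ne_top
    (map_ellipseCurve_le_smul_lineElement ha hb)

theorem coeFn_pullback (ha : 0 < a) (hb : 0 < b) (f : Lp ℂ 2 (lineElement a b)) :
    pullback ha hb f =ᵐ[angleMeasure] f ∘ ellipseCurve a b :=
  coeFn_compOperator _ _ _ f

theorem norm_deriv_smul_npKernel_mul_ae_eq (ha : 0 < a) (hb : 0 < b) (t : ℝ)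
    (f : Lp ℂ 2 (lineElement a b)) :
    (fun s => ‖deriv (ellipseCurve a b) s‖ •
        ((npKernel a b (ellipseCurve a b t) (ellipseCurve a b s) : ℂ) * f (ellipseCurve a b s)))
      =ᵐ[angleMeasure] fun s =>
        npSmoothKernel a b (ellipseCurve a b t) s * pullback ha hb f s := by
  filter_upwards [ae_restrict_of_ae (ae_cos_sub_ne_one t), coeFn_pullback ha hb f] with s hs hf
  rw [npSmoothKernel_ellipseCurve ha.ne' hb.ne', ← norm_deriv_mul_npKernel ha hb hs, hf,
    Complex.real_smul, Complex.ofReal_mul, mul_assoc, Function.comp_apply]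

theorem integrable_npKernel_mul (ha : 0 < a) (hb : 0 < b) (t : ℝ) (f : Lp ℂ 2 (lineElement a b)) :
    Integrable (fun y => (npKernel a b (ellipseCurve a b t) y : ℂ) * f y) (lineElement a b) := by
  rw [integrable_lineElement_iff (aestronglyMeasurable_npKernel_mul _ f),
    integrable_congr (norm_deriv_smul_npKernel_mul_ae_eq ha hb t f)]
  exact (isBoundedKernel_npSmoothKernel ha hb).integrable_mul
    ((Lp.memLp _).integrable one_le_two) _

theorem integral_npKernel_mul (ha : 0 < a) (hb : 0 < b) (t : ℝ) (f : Lp ℂ 2 (lineElement a b)) :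
    ∫ y, (npKernel a b (ellipseCurve a b t) y : ℂ) * f y ∂lineElement a b
      = ∫ s, npSmoothKernel a b (ellipseCurve a b t) s * pullback ha hb f s ∂angleMeasure := by
  rw [integral_lineElement (aestronglyMeasurable_npKernel_mul _ f)]
  exact integral_congr_ae (norm_deriv_smul_npKernel_mul_ae_eq ha hb t f)

theorem tendsto_setIntegral_lt_norm_sub {E G : Type*} [NormedAddCommGroup E] [MeasurableSpace E]
    [OpensMeasurableSpace E] [NormedAddCommGroup G] [NormedSpace ℝ G] {σ : Measure E} {x : E}
    {f : E → G} (hf : Integrable f σ) (hx : f x = 0) :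
    Tendsto (fun ε : ℝ => ∫ y in {y : E | ε < ‖x - y‖}, f y ∂σ) (𝓝[>] 0) (𝓝 (∫ y, f y ∂σ)) := by
  have hm (ε : ℝ) : MeasurableSet {y : E | ε < ‖x - y‖} :=
    (isOpen_lt continuous_const (by fun_prop)).measurableSet
  simp_rw [← integral_indicator (hm _)]
  refine tendsto_integral_filter_of_dominated_convergence (fun y => ‖f y‖)
    (.of_forall fun ε => hf.aestronglyMeasurable.indicator (hm ε))
    (.of_forall fun ε => ae_of_all _ fun y => norm_indicator_le_norm_self _ _) hf.norm
    (ae_of_all _ fun y => tendsto_nhds_of_eventually_eq ?_)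
  rcases eq_or_ne x y with rfl | hxy
  · exact .of_forall fun ε => by rw [Set.indicator_apply, hx, ite_self]
  · filter_upwards [Ioo_mem_nhdsGT (norm_sub_pos_iff.2 hxy)] with ε hε
    exact Set.indicator_of_mem (s := {y : E | ε < ‖x - y‖}) hε.2 f

theorem npKernel_self (a b : ℝ) (x : Plane) : npKernel a b x x = 0 := by
  rw [npKernel, sub_self, inner_zero_left, zero_div, mul_zero]

theorem IsNPOperator.unique {T K : HHalf a b →L[ℂ] HHalf a b} (hT : IsNPOperator T)
    (hK : IsNPOperator K) : T = K := by
  refine ContinuousLinearMap.ext fun φ => sobolevHalf_ext (Lp.ext ?_)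
  filter_upwards [hT φ, hK φ] with x h₁ h₂
  exact tendsto_nhds_unique h₁ h₂

/-- The restriction to `H^{1/2}` of the pull-back to the parameter interval. -/
def npPullback (ha : 0 < a) (hb : 0 < b) : HHalf a b →L[ℂ] Lp ℂ 2 angleMeasure :=
  pullback ha hb ∘L WithLp.fstL 2 ℂ _ _ ∘L (sobolevHalf (lineElement a b)).subtypeL

theorem npPullback_apply (ha : 0 < a) (hb : 0 < b) (φ : HHalf a b) :
    npPullback ha hb φ = pullback ha hb φ.toLp := rfl

/-- The integral operator with kernel `npSmoothKernel`, from the parameter interval to the boundary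
of the ellipse. -/
def npSmoothing (ha : 0 < a) (hb : 0 < b) : Lp ℂ 2 angleMeasure →L[ℂ] HHalf a b :=
  smoothingOperator (lineElement a b) angleMeasure (isBoundedKernel_npSmoothKernel ha hb)
    (exists_lipschitzWith_npSmoothKernel ha hb).choose_spec

theorem coeFn_npSmoothing (ha : 0 < a) (hb : 0 < b) (f : Lp ℂ 2 angleMeasure) :
    (npSmoothing ha hb f).toLp =ᵐ[lineElement a b]
      fun x => ∫ s, npSmoothKernel a b x s * f s ∂angleMeasure :=
  coeFn_smoothingOperator _ _ f

/-- The Neumann–Poincaré operator of an ellipse on `H^{1/2}`. -/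
def npOperator (ha : 0 < a) (hb : 0 < b) : HHalf a b →L[ℂ] HHalf a b :=
  npSmoothing ha hb ∘L npPullback ha hb

theorem isNPOperator_npOperator (ha : 0 < a) (hb : 0 < b) : IsNPOperator (npOperator ha hb) := by
  intro φ
  filter_upwards [ae_lineElement_mem_range ha hb, coeFn_npSmoothing ha hb (npPullback ha hb φ)]
  rintro _ ⟨t, rfl⟩ hφ
  have hlim := tendsto_setIntegral_lt_norm_sub (integrable_npKernel_mul ha hb t φ.toLp)
    (by rw [npKernel_self, Complex.ofReal_zero, zero_mul])
  rwa [integral_npKernel_mul ha hb, ← npPullback_apply, ← hφ] at hlim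

theorem isNPOperator_iff (ha : 0 < a) (hb : 0 < b) {T : HHalf a b →L[ℂ] HHalf a b} :
    IsNPOperator T ↔ T = npOperator ha hb :=
  ⟨fun hT => hT.unique (isNPOperator_npOperator ha hb),
    fun h => h ▸ isNPOperator_npOperator ha hb⟩

theorem npPullback_comp_npSmoothing (ha : 0 < a) (hb : 0 < b) :
    npPullback ha hb ∘L npSmoothing ha hb
      = npAngleOperator (abs_thirdFlattening_lt_one ha hb) := by
  refine ContinuousLinearMap.ext fun f => Lp.ext ?_
  have hγ := quasiMeasurePreserving_of_map_le_smul (continuous_ellipseCurve a b).measurable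
    (map_ellipseCurve_le_smul_lineElement ha hb)
  filter_upwards [coeFn_pullback ha hb (npSmoothing ha hb f).toLp,
    hγ.ae (coeFn_npSmoothing ha hb f),
    (isBoundedKernel_npProfile_cos_add
      (abs_thirdFlattening_lt_one ha hb)).coeFn_integralOperator 2 f] with t hpull hsmooth hangle
  refine (hpull.trans hsmooth).trans (Eq.trans ?_ hangle.symm)
  simp only [npSmoothKernel_ellipseCurve ha.ne' hb.ne']

theorem spectrum_npOperator_sdiff_zero (ha : 0 < a) (hb : 0 < b) :
    spectrum ℂ (npOperator ha hb) \ {0}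
      = spectrum ℂ (npAngleOperator (abs_thirdFlattening_lt_one ha hb)) \ {0} := by
  rw [npOperator, spectrum_comp_sdiff_zero_comm, npPullback_comp_npSmoothing]

theorem spectrum_npOperator_subset (ha : 0 < a) (hb : 0 < b) :
    spectrum ℂ (npOperator ha hb) ⊆ (fun t : ℝ => (t : ℂ)) '' Set.Icc (-(1 / 2)) (1 / 2) := by
  intro z hz
  rcases eq_or_ne z 0 with rfl | hz0
  · exact ⟨0, by norm_num, Complex.ofReal_zero⟩
  · have hz' := (spectrum_npOperator_sdiff_zero ha hb).subset ⟨hz, hz0⟩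
    exact spectrum_npAngleOperator_subset _ hz'.1

theorem pow_thirdFlattening_div_two_mem_spectrum_npOperator (ha : 0 < a) (hb : 0 < b)
    (hab : a ≠ b) (n : ℕ) :
    ((thirdFlattening a b ^ (n + 1) / 2 : ℝ) : ℂ) ∈ spectrum ℂ (npOperator ha hb) ∧
      ((-(thirdFlattening a b ^ (n + 1) / 2) : ℝ) : ℂ) ∈ spectrum ℂ (npOperator ha hb) := by
  have hr : thirdFlattening a b ^ (n + 1) / 2 ≠ 0 :=
    div_ne_zero (pow_ne_zero _ (div_ne_zero (sub_ne_zero.2 hab) (add_pos ha hb).ne')) two_ne_zero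
  have hsub := (spectrum_npOperator_sdiff_zero ha hb).superset
  exact ⟨(hsub ⟨pow_div_two_mem_spectrum_npAngleOperator _ (n + 1),
      Complex.ofReal_ne_zero.2 hr⟩).1,
    (hsub ⟨neg_pow_div_two_mem_spectrum_npAngleOperator _ n,
      Complex.ofReal_ne_zero.2 (neg_ne_zero.2 hr)⟩).1⟩

end NPOperator

section Density

theorem exists_abs_pow_succ_sub_lt {r x ε : ℝ} (h0 : 0 < r) (h1 : r < 1) (hr : 1 - r < ε)
    (hx : x ∈ Set.Icc 0 1) : ∃ n : ℕ, |r ^ (n + 1) - x| < ε := by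
  rcases hx.1.eq_or_lt with rfl | hx0
  · obtain ⟨n, hn⟩ := exists_pow_lt_of_lt_one ((sub_pos.2 h1).trans hr) h1
    refine ⟨n, ?_⟩
    rw [sub_zero, abs_of_pos (by positivity)]
    exact (pow_le_pow_of_le_one h0.le h1.le n.le_succ).trans_lt hn
  · obtain ⟨n, hlt, hle⟩ := exists_nat_pow_near_of_lt_one hx0 hx.2 h0 h1
    refine ⟨n, ?_⟩
    calc |r ^ (n + 1) - x| = x - r ^ (n + 1) := by rw [abs_sub_comm, abs_of_pos (sub_pos.2 hlt)]
      _ ≤ r ^ n - r ^ (n + 1) := sub_le_sub_right hle _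
      _ = r ^ n * (1 - r) := by ring
      _ ≤ 1 - r := mul_le_of_le_one_left (sub_pos.2 h1).le (pow_le_one₀ h0.le h1.le)
      _ < ε := hr

theorem one_sub_thirdFlattening_le {a b : ℝ} (ha : 0 < a) (hb : 0 ≤ b) :
    1 - thirdFlattening a b ≤ 2 * (b / a) := by
  have : 0 < a + b := add_pos_of_pos_of_nonneg ha hb
  calc 1 - thirdFlattening a b = 2 * (b / (a + b)) := by
        rw [thirdFlattening]
        field_simp
        ring
    _ ≤ 2 * (b / a) := by
        gcongr
        exact le_add_of_nonneg_right hb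

theorem exists_mem_spectrum_npOperator_dist_lt {a b x ε : ℝ} (ha : 0 < a) (hb : 0 < b)
    (hab : b < a) (hε : 2 * (b / a) < ε) (hx : x ∈ Set.Icc (-(1 / 2)) (1 / 2)) :
    ∃ z ∈ spectrum ℂ (npOperator ha hb), dist (x : ℂ) z < ε := by
  have h0 : 0 < thirdFlattening a b := div_pos (sub_pos.2 hab) (add_pos ha hb)
  have h1 := (abs_lt.1 (abs_thirdFlattening_lt_one ha hb)).2
  have h2x : 2 * |x| ∈ Set.Icc 0 1 := ⟨by positivity, by linarith [abs_le.2 hx]⟩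
  obtain ⟨n, hn⟩ := exists_abs_pow_succ_sub_lt h0 h1
    ((one_sub_thirdFlattening_le ha hb.le).trans_lt hε) h2x
  obtain ⟨hpos, hneg⟩ := pow_thirdFlattening_div_two_mem_spectrum_npOperator ha hb hab.ne' n
  rw [abs_lt] at hn
  rcases abs_cases x with ⟨hx, -⟩ | ⟨hx, -⟩ <;> rw [hx] at hn
  · refine ⟨_, hpos, ?_⟩
    rw [Complex.isometry_ofReal.dist_eq, Real.dist_eq, abs_lt]
    constructor <;> linarith
  · refine ⟨_, hneg, ?_⟩
    rw [Complex.isometry_ofReal.dist_eq, Real.dist_eq, abs_lt]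
    constructor <;> linarith

end Density

end

theorem mainTheorem3_general {ι : Type*} (a b : ι → ℝ) (ha : ∀ j, 0 < a j) (hb : ∀ j, 0 < b j)
    (hclosure : 0 ∈ closure (Set.range fun j => b j / a j)) :
    ∃ K : ∀ j, HHalf (a j) (b j) →L[ℂ] HHalf (a j) (b j),
      (∀ j, ∀ T : HHalf (a j) (b j) →L[ℂ] HHalf (a j) (b j), IsNPOperator T ↔ T = K j) ∧
      closure (⋃ j, spectrum ℂ (K j)) =
        (fun t : ℝ => (t : ℂ)) '' Set.Icc (-(1 / 2) : ℝ) (1 / 2) := by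
  refine ⟨fun j => npOperator (ha j) (hb j), fun j T => isNPOperator_iff (ha j) (hb j), ?_⟩
  refine Set.Subset.antisymm ?_ ?_
  · exact closure_minimal (Set.iUnion_subset fun j => spectrum_npOperator_subset (ha j) (hb j))
      (isCompact_Icc.image Complex.continuous_ofReal).isClosed
  · rintro _ ⟨x, hx, rfl⟩
    refine Metric.mem_closure_iff.2 fun ε hε => ?_
    obtain ⟨_, ⟨j, rfl⟩, hj⟩ := Metric.mem_closure_iff.1 hclosure (min 1 (ε / 2)) (by positivity)
    rw [dist_zero_left, Real.norm_of_nonneg (div_pos (hb j) (ha j)).le, lt_min_iff,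
      div_lt_one (ha j)] at hj
    obtain ⟨z, hz, hdist⟩ := exists_mem_spectrum_npOperator_dist_lt (ha j) (hb j) hj.1
      ((lt_div_iff₀' two_pos).1 hj.2) hx
    exact ⟨z, Set.mem_iUnion.2 ⟨j, hz⟩, hdist⟩

theorem mainTheorem3 (a b : ℕ → ℝ) (hb : ∀ j, 0 < b j) (hab : ∀ j, b j < a j)
    (hlim : Tendsto (fun j => b j / a j) atTop (𝓝 0)) :
    ∃ K : ∀ j, HHalf (a j) (b j) →L[ℂ] HHalf (a j) (b j),
      (∀ j, ∀ T : HHalf (a j) (b j) →L[ℂ] HHalf (a j) (b j), IsNPOperator T ↔ T = K j) ∧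
      closure (⋃ j, spectrum ℂ (K j)) =
        (fun t : ℝ => (t : ℂ)) '' Set.Icc (-(1 / 2) : ℝ) (1 / 2) := by
  exact mainTheorem3_general a b (fun j => (hb j).trans (hab j)) hb
    (mem_closure_of_tendsto hlim (.of_forall Set.mem_range_self))
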